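/- Let \((X,d,\mathfrak m)\) be a metric measure space: \((X,d)\) is a complete separable metric space and \(\mathfrak m\) is a Borel measure on \(X\) that is finite on bounded Borel sets. Let \(p\in[1,\infty)\) and \(\tfrac1p+\tfrac1q=1\), \(q\in(1,\infty]\). A curve is a continuous map \(\gamma\colon[a_\gamma,b_\gamma]\to X\), \(a_\gamma<b_\gamma\). If \(\gamma\) has finite length, \(\int_\gamma\rho\,ds:=\int_{[a_\gamma,b_\gamma]}\rho\circ\gamma\,ds_\gamma\), where \(s_\gamma\) is the Lebesgue–Stieltjes measure of the length function \(t\mapsto\ell(\gamma|_{[a_\gamma,t]})\); otherwise \(\int_\gamma\rho\,ds:=+\infty\). For a family \(\Gamma\) of curves and \(\lambda\in\{0,1\}\), \[ \mathrm{Mod}_p^\lambda(\Gamma):=\inf\Big\{\int\rho^p\,d\mathfrak m\ :\ \rho\colon X\to[0,\infty]\text{ Borel},\ \lambda\big(\rho(\gamma_{a_\gamma})+\rho(\gamma_{b_\gamma})\big)+\int_\gamma\rho\,ds\ge1\ \ \forall\gamma\in\Gamma\Big\}, \] and \(\mathrm{Mod}_p:=\mathrm{Mod}_p^0\); a property holds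 for \(\mathrm{Mod}_p\)-a.e. curve of a family if the curves of the family for which it fails form a family of \(\mathrm{Mod}_p\) zero. Let \(|\dot\gamma_t|\) be the metric speed. Let \(\mathrm{AC}^q([0,1];X)\) be the set of curves \(\gamma\colon[0,1]\to X\) for which there is a non-negative \(g\in L^q(0,1)\) with \(d(\gamma_s,\gamma_t)\le\int_s^tg\) for all \(s<t\), and let \(\mathrm{LIP}([0,1];X)\) be the set of Lipschitz curves on \([0,1]\). Let \(f\colon X\to\mathbb R\) be Borel with \(\int|f|^p\,d\mathfrak m<\infty\) and \(\rho\colon X\to[0,\infty]\) Borel with \(\int\rho^p\,d\mathfrak m<\infty\). Set \[ \Gamma^q_{f,\rho}:=\Big\{\gamma\in\mathrm{AC}^q([0,1];X)\ :\ |f(\gamma_1)-f(\gamma_0)|>\int_\gamma\rho\,ds\Big\}, \] and let \(C_{f,\rho}\) be the set of \(\gamma\in\mathrm{LIP}([0,1];X)\) such that \(f\circ\gamma\) has an absolutely continuous representative \(f_\gamma\colon[0,1]\to\mathbb R\) (that is, \(f_\gamma=f\circ\gamma\) a.e. on \([0,1]\)) satisfying \(|(f_\gamma)'_t|\le\rho(\gamma_t)|\dot\gamma_t|<+\infty\)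 for a.e. \(t\in(0,1)\) (with \(\infty\cdot0=0\)). Assume \(\mathrm{Mod}_p^1(\Gamma^q_{f,\rho})=0\). Then there is an \(\mathfrak m\)-measurable function \(\hat f\colon X\to\mathbb R\) with \(\hat f=f\) \(\mathfrak m\)-a.e. such that 1. for \(\mathrm{Mod}_p\)-a.e. nonconstant curve \(\gamma\in C_{f,\rho}\), \(\hat f(\gamma_t)=f_\gamma(t)\) for every \(t\in[0,1]\); 2. \(\mathrm{Mod}_p\)-a.e. curve \(\gamma\in\mathrm{LIP}([0,1];X)\) with \(|\dot\gamma_t|>0\) for a.e. \(t\in(0,1)\) belongs to \(C_{f,\rho}\); 3. for \(\mathrm{Mod}_p\)-a.e. nonconstant curve \(\gamma\in\mathrm{LIP}([0,1];X)\), the function \(\hat f\circ\gamma\) is absolutely continuous on \([0,1]\), satisfies \(|(\hat f\circ\gamma)'_t|\le\rho(\gamma_t)|\dot\gamma_t|<+\infty\) for a.e. \(t\in(0,1)\), and \(\hat f(\gamma_t)=f(\gamma_t)\) for a.e. \(t\in(0,1)\) with \(|\dot\gamma_t|>0\). -/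

import Mathlib

open Set Filter Topology MeasureTheory
open scoped ENNReal NNReal

namespace MetricCurve

/-- A curve in `X`: a continuous map `[a, b] → X` on a nontrivial compact interval. -/
structure Curve (X : Type*) [TopologicalSpace X] where
  a : ℝ
  b : ℝ
  a_lt_b : a < b
  toMap : C(Icc a b, X)

/-- A curve is evaluated at real parameters through its extension by constants outside `[a, b]`. -/
noncomputable instance {X : Type*} [TopologicalSpace X] :
    CoeFun (Curve X) (fun _ => ℝ → X) where
  coe γ := IccExtend γ.a_lt_b.le γ.toMap

section Metric

variable {X : Type*} [MetricSpace X]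

/-- The length of the subcurve `γ|_[a, min t b]`, as an extended real. -/
noncomputable def lengthUpTo (γ : Curve X) (t : ℝ) : ℝ≥0∞ :=
  eVariationOn γ (Icc γ.a (min t γ.b))

/-- A curve is rectifiable if its length is finite. -/
def Rectifiable (γ : Curve X) : Prop :=
  eVariationOn γ (Icc γ.a γ.b) ≠ ∞

theorem Rectifiable.monotone_lengthUpTo {γ : Curve X} (h : Rectifiable γ) :
    Monotone (fun t => (lengthUpTo γ t).toReal) := by
  intro s t hst
  refine ENNReal.toReal_mono ?_ ?_
  · exact ne_top_of_le_ne_top h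
      (eVariationOn.mono _ (Icc_subset_Icc_right (min_le_right _ _)))
  · exact eVariationOn.mono _ (Icc_subset_Icc_right (min_le_min_right _ hst))

/-- The total variation measure `s_γ` of a rectifiable curve, i.e. the Lebesgue–Stieltjes measure
on `[a, b]` of the length function `t ↦ ℓ(γ|_[a, t])`. -/
noncomputable def variationMeasure (γ : Curve X) (h : Rectifiable γ) : Measure ℝ :=
  h.monotone_lengthUpTo.stieltjesFunction.measure.restrict (Icc γ.a γ.b)

open Classical in
/-- The path integral `∫_γ ρ ds`, equal to `∞` by convention if `γ` is not rectifiable. -/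
noncomputable def pathIntegral (γ : Curve X) (ρ : X → ℝ≥0∞) : ℝ≥0∞ :=
  if h : Rectifiable γ then ∫⁻ t, ρ (γ t) ∂(variationMeasure γ h) else ∞

open Classical in
/-- The metric speed `|γ̇_t|`, for `t` in the interior of the domain of `γ`: the limit of
`d(γ_{t+h}, γ_t) / |h|` as `h → 0` if it exists, and `∞` otherwise. -/
noncomputable def metricSpeed (γ : Curve X) (t : ℝ) : ℝ≥0∞ :=
  if h : ∃ v : ℝ≥0∞,
      Tendsto (fun h : ℝ => edist (γ (t + h)) (γ t) / ENNReal.ofReal |h|) (𝓝[≠] 0) (𝓝 v)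
  then h.choose else ∞

/-- Nonconstant curves. -/
def Nonconstant (γ : Curve X) : Prop :=
  ∃ s ∈ Icc γ.a γ.b, ∃ t ∈ Icc γ.a γ.b, γ s ≠ γ t

/-- `LIP([0,1]; X)`. -/
def LipCurves (X : Type*) [MetricSpace X] : Set (Curve X) :=
  {γ | γ.a = 0 ∧ γ.b = 1 ∧ ∃ K : ℝ≥0, LipschitzOnWith K γ (Icc 0 1)}

/-- `AC^q([0,1]; X)`. -/
def ACCurves (X : Type*) [MetricSpace X] (q : ℝ≥0∞) : Set (Curve X) :=
  {γ | γ.a = 0 ∧ γ.b = 1 ∧ ∃ g : ℝ → ℝ, (∀ r, 0 ≤ g r) ∧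
    MemLp g q (volume.restrict (Ioo 0 1)) ∧
    ∀ s ∈ Icc (0 : ℝ) 1, ∀ t ∈ Icc (0 : ℝ) 1, s < t → dist (γ s) (γ t) ≤ ∫ r in s..t, g r}

/-- `ρ` is `lam`-admissible for the family `Γ` (with the convention `0 * ∞ = 0`). -/
def Admissible [MeasurableSpace X] (lam : ℝ≥0∞) (Γ : Set (Curve X)) (ρ : X → ℝ≥0∞) : Prop :=
  Measurable ρ ∧ ∀ γ ∈ Γ, 1 ≤ lam * (ρ (γ γ.a) + ρ (γ γ.b)) + pathIntegral γ ρ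

/-- The `(p, lam)`-modulus of a family of curves (`lam ∈ {0, 1}`). -/
noncomputable def modulus [MeasurableSpace X] (m : Measure X) (p : ℝ) (lam : ℝ≥0∞)
    (Γ : Set (Curve X)) : ℝ≥0∞ :=
  ⨅ (ρ : X → ℝ≥0∞) (_ : Admissible lam Γ ρ), ∫⁻ x, ρ x ^ p ∂m

/-- The property `P` holds for `Mod_p`-a.e. curve of the family `Γ`, where `Mod_p = Mod_p^0`. -/
def ModAE [MeasurableSpace X] (m : Measure X) (p : ℝ) (Γ : Set (Curve X))
    (P : Curve X → Prop) : Prop :=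
  modulus m p 0 {γ | γ ∈ Γ ∧ ¬ P γ} = 0

/-- The family `Γ^q_{f,ρ}` of `q`-absolutely continuous curves along which
`|f(γ_1) - f(γ_0)| > ∫_γ ρ ds`. -/
def badCurves (q : ℝ≥0∞) (f : X → ℝ) (ρ : X → ℝ≥0∞) : Set (Curve X) :=
  {γ | γ ∈ ACCurves X q ∧ pathIntegral γ ρ < ENNReal.ofReal |f (γ 1) - f (γ 0)|}

/-- `|u'_t| ≤ ρ(γ_t) |γ̇_t| < ∞` for a.e. `t ∈ (0,1)` (with the convention `∞ * 0 = 0`). -/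
def DerivBound (ρ : X → ℝ≥0∞) (γ : Curve X) (u : ℝ → ℝ) : Prop :=
  ∀ᵐ t ∂(volume.restrict (Ioo (0 : ℝ) 1)), ∃ d : ℝ, HasDerivAt u d t ∧
    ENNReal.ofReal |d| ≤ ρ (γ t) * metricSpeed γ t ∧ ρ (γ t) * metricSpeed γ t < ∞

/-- `u` (restricted to `[0,1]`) is an absolutely continuous representative `f_γ` of `f ∘ γ`
satisfying `|u'_t| ≤ ρ(γ_t) |γ̇_t| < ∞` for a.e. `t`. It is unique as a function on `[0,1]`. -/
def IsACRep (f : X → ℝ) (ρ : X → ℝ≥0∞) (γ : Curve X) (u : ℝ → ℝ) : Prop :=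
  AbsolutelyContinuousOnInterval u 0 1 ∧
  (∀ᵐ t ∂(volume.restrict (Ioo (0 : ℝ) 1)), u t = f (γ t)) ∧
  DerivBound ρ γ u

/-- The family `C_{f,ρ}` of Lipschitz curves `γ : [0,1] → X` such that `f ∘ γ` has an absolutely
continuous representative `f_γ` with `|(f_γ)'_t| ≤ ρ(γ_t) |γ̇_t| < ∞` for a.e. `t`. -/
def goodCurves (f : X → ℝ) (ρ : X → ℝ≥0∞) : Set (Curve X) :=
  {γ | γ ∈ LipCurves X ∧ ∃ u : ℝ → ℝ, IsACRep f ρ γ u}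

end Metric

end MetricCurve

open MetricCurve

/-! Since the endpoint modulus of the bad curves vanishes, one `p`-integrable `k ≥ ρ` satisfies
`k(γ_0) + k(γ_1) + ∫_γ k = ∞` on each of them (`exists_obstructs`). Hence `|f(γ_1) - f(γ_0)| ≤ ∫_γ
ρ` for every Lipschitz curve with finite `∫_γ k` and finite `k` at both ends.

The representative at `x` is the supremum of `f(y) - ∫_γ ρ` over Lipschitz curves `γ` from `x` to
`y` with `k(y)` and `∫_γ k` finite. Gluing two such curves at `x` bounds `|f(y₂) - f(y₁)|` even if
`k(x) = ∞`, so `|fhat(x) - f(y)| ≤ ∫_γ ρ`; constant curves give `fhat = f` on `{k < ∞}`. If `∫_γ k <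
∞`, each subcurve either meets `{k < ∞}`, and the estimate passes through that point, or has zero
speed a.e. and is constant. So `ρ` is an upper gradient of `fhat` along `γ`
(`Obstructs.abs_goodRep_sub_goodRep_le`), which gives absolute continuity and the derivative bound
(`Obstructs.goodRep_comp`).

Agreement with `f_γ` is a zero-derivative argument (`Obstructs.goodRep_eq_of_isACRep`). All
exceptional curves satisfy `∫_γ k = ∞`, so they have modulus zero. -/

namespace MetricCurve

/-! ### Metric speed and integration against it -/

variable {X : Type*} [MetricSpace X]

open Classical in
/-- The metric speed of a map `g : ℝ → X`; `metricSpeed γ` is the case of a curve `γ`. -/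
noncomputable def mspeed (g : ℝ → X) (t : ℝ) : ℝ≥0∞ :=
  if h : ∃ v : ℝ≥0∞,
      Tendsto (fun h : ℝ => edist (g (t + h)) (g t) / ENNReal.ofReal |h|) (𝓝[≠] 0) (𝓝 v)
  then h.choose else ∞

theorem metricSpeed_eq_mspeed (γ : Curve X) (t : ℝ) : metricSpeed γ t = mspeed γ t := rfl

theorem mspeed_eq_of_tendsto {g : ℝ → X} {t : ℝ} {v : ℝ≥0∞}
    (h : Tendsto (fun h : ℝ => edist (g (t + h)) (g t) / ENNReal.ofReal |h|) (𝓝[≠] 0) (𝓝 v)) :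
    mspeed g t = v := by
  have hex : ∃ v : ℝ≥0∞,
      Tendsto (fun h : ℝ => edist (g (t + h)) (g t) / ENNReal.ofReal |h|) (𝓝[≠] 0) (𝓝 v) := ⟨v, h⟩
  rw [mspeed, dif_pos hex]
  exact tendsto_nhds_unique hex.choose_spec h

/-- Quantifying over all `v` also transfers non-existence of the limit; both speeds are then the
default `∞`, and `c * ∞ = ∞` because `c ≠ 0`. -/
theorem mspeed_eq_of_tendsto_iff {X' : Type*} [MetricSpace X'] {g : ℝ → X} {g' : ℝ → X'} {t t' : ℝ}
    {c : ℝ≥0∞} (hc : c ≠ 0) (hc' : c ≠ ∞)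
    (h : ∀ v : ℝ≥0∞,
      Tendsto (fun h : ℝ => edist (g (t + h)) (g t) / ENNReal.ofReal |h|) (𝓝[≠] 0) (𝓝 v) ↔
      Tendsto (fun h : ℝ => edist (g' (t' + h)) (g' t') / ENNReal.ofReal |h|) (𝓝[≠] 0)
        (𝓝 (c * v))) :
    mspeed g' t' = c * mspeed g t := by
  by_cases hex : ∃ v : ℝ≥0∞,
      Tendsto (fun h : ℝ => edist (g (t + h)) (g t) / ENNReal.ofReal |h|) (𝓝[≠] 0) (𝓝 v)
  · obtain ⟨v, hv⟩ := hex
    rw [mspeed_eq_of_tendsto hv, mspeed_eq_of_tendsto ((h v).1 hv)]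
  · have hex' : ¬ ∃ v : ℝ≥0∞,
        Tendsto (fun h : ℝ => edist (g' (t' + h)) (g' t') / ENNReal.ofReal |h|) (𝓝[≠] 0)
          (𝓝 v) := by
      rintro ⟨v, hv⟩
      refine hex ⟨c⁻¹ * v, (h _).2 ?_⟩
      rwa [← mul_assoc, ENNReal.mul_inv_cancel hc hc', one_mul]
    rw [mspeed, mspeed, dif_neg hex, dif_neg hex', ENNReal.mul_top hc]

theorem mspeed_congr {g g' : ℝ → X} {t : ℝ} (h : g =ᶠ[𝓝 t] g') : mspeed g t = mspeed g' t := by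
  have h1 : ∀ᶠ r in 𝓝[≠] (0 : ℝ), g (t + r) = g' (t + r) := by
    have : Tendsto (fun r : ℝ => t + r) (𝓝[≠] 0) (𝓝 t) := by
      have : Tendsto (fun r : ℝ => t + r) (𝓝 0) (𝓝 (t + 0)) := by
        exact (continuous_const.add continuous_id).tendsto 0
      rw [add_zero] at this
      exact this.mono_left nhdsWithin_le_nhds
    exact this.eventually h
  rw [← one_mul (mspeed g' t)]
  refine mspeed_eq_of_tendsto_iff one_ne_zero ENNReal.one_ne_top fun v => ?_
  rw [one_mul]
  refine tendsto_congr' ?_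
  filter_upwards [h1] with r hr
  rw [hr, h.eq_of_nhds]

theorem mspeed_comp_affine (g : ℝ → X) (c : ℝ) {d : ℝ} (hd : d ≠ 0) (t : ℝ) :
    mspeed (fun r => g (c + d * r)) t = ENNReal.ofReal |d| * mspeed g (c + d * t) := by
  have hd0 : ENNReal.ofReal |d| ≠ 0 := by simpa using hd
  refine mspeed_eq_of_tendsto_iff hd0 ENNReal.ofReal_ne_top fun v => ?_
  have hmap : map (fun r : ℝ => d * r) (𝓝[≠] 0) = 𝓝[≠] 0 := by
    have := (Homeomorph.mulLeft₀ d hd).isOpenEmbedding.toIsEmbedding.map_nhdsWithin_eq {0}ᶜ 0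
    simp only [Homeomorph.coe_mulLeft₀, mul_zero] at this
    rw [this]
    congr 1
    ext x
    simp only [mem_image, mem_compl_iff, mem_singleton_iff]
    constructor
    · rintro ⟨y, hy, rfl⟩
      exact mul_ne_zero hd hy
    · intro hx
      exact ⟨d⁻¹ * x, mul_ne_zero (inv_ne_zero hd) hx, by field_simp⟩
  have key : ∀ h : ℝ, edist (g (c + d * (t + h))) (g (c + d * t)) / ENNReal.ofReal |h| =
      ENNReal.ofReal |d| *
        (edist (g (c + d * t + d * h)) (g (c + d * t)) / ENNReal.ofReal |d * h|) := by
    intro h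
    rw [abs_mul, ENNReal.ofReal_mul (abs_nonneg d), mul_add, add_assoc]
    rw [div_eq_mul_inv, div_eq_mul_inv, ENNReal.mul_inv (Or.inl hd0) (Or.inl ENNReal.ofReal_ne_top)]
    rw [mul_left_comm, ← mul_assoc (ENNReal.ofReal |d|),
      ENNReal.mul_inv_cancel hd0 ENNReal.ofReal_ne_top, one_mul]
  simp_rw [key]
  conv_lhs => rw [← hmap, tendsto_map'_iff]
  constructor
  · intro h
    exact ENNReal.Tendsto.const_mul h (Or.inr ENNReal.ofReal_ne_top)
  · intro h
    have := ENNReal.Tendsto.const_mul (a := (ENNReal.ofReal |d|)⁻¹) h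
      (Or.inr (ENNReal.inv_ne_top.2 hd0))
    simp only [← mul_assoc, ENNReal.inv_mul_cancel hd0 ENNReal.ofReal_ne_top, one_mul] at this
    exact this

theorem mspeed_const (x : X) (t : ℝ) : mspeed (fun _ => x) t = 0 := by
  apply mspeed_eq_of_tendsto
  simp

/-- The integral of `F` against the metric speed of `g` between the parameters `a` and `b`. -/
noncomputable def speedIntegral (F : X → ℝ≥0∞) (g : ℝ → X) (a b : ℝ) : ℝ≥0∞ :=
  ∫⁻ t in uIcc a b, F (g t) * mspeed g t

theorem speedIntegral_symm (F : X → ℝ≥0∞) (g : ℝ → X) (a b : ℝ) :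
    speedIntegral F g a b = speedIntegral F g b a := by
  rw [speedIntegral, speedIntegral, uIcc_comm]

theorem speedIntegral_self (F : X → ℝ≥0∞) (g : ℝ → X) (a : ℝ) : speedIntegral F g a a = 0 := by
  simp [speedIntegral]

theorem speedIntegral_mono_set (F : X → ℝ≥0∞) (g : ℝ → X) {a b c d : ℝ}
    (h : uIcc a b ⊆ uIcc c d) : speedIntegral F g a b ≤ speedIntegral F g c d :=
  lintegral_mono_set h

theorem speedIntegral_mono {F G : X → ℝ≥0∞} (h : F ≤ G) (g : ℝ → X) (a b : ℝ) :
    speedIntegral F g a b ≤ speedIntegral G g a b :=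
  lintegral_mono fun t => mul_le_mul_left (h (g t)) _

theorem speedIntegral_add (F : X → ℝ≥0∞) (g : ℝ → X) {a b c : ℝ} (hab : a ≤ b) (hbc : b ≤ c) :
    speedIntegral F g a b + speedIntegral F g b c = speedIntegral F g a c := by
  simp only [speedIntegral, uIcc_of_le hab, uIcc_of_le hbc, uIcc_of_le (hab.trans hbc)]
  rw [← Icc_union_Ioc_eq_Icc hab hbc, lintegral_union measurableSet_Ioc]
  · rw [restrict_Ioc_eq_restrict_Icc]
  · exact Set.disjoint_left.2 fun x hx hx' => not_lt.2 hx.2 hx'.1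

/-- The speed at an endpoint depends on values outside the interval, so the comparison is made on
the open interval, where the two maps agree near every point. -/
theorem speedIntegral_congr (F : X → ℝ≥0∞) {g g' : ℝ → X} {a b : ℝ} (h : EqOn g g' (uIcc a b)) :
    speedIntegral F g a b = speedIntegral F g' a b := by
  wlog hab : a ≤ b generalizing a b
  · rw [speedIntegral_symm, speedIntegral_symm F g']
    exact this (by rwa [uIcc_comm]) (le_of_not_ge hab)
  simp only [speedIntegral]
  rw [uIcc_of_le hab] at h ⊢
  rw [← restrict_Ioo_eq_restrict_Icc]
  refine setLIntegral_congr_fun measurableSet_Ioo fun t ht => ?_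
  have h1 : g =ᶠ[𝓝 t] g' := by
    filter_upwards [Icc_mem_nhds ht.1 ht.2] with r hr using h hr
  simp only [h1.eq_of_nhds, mspeed_congr h1]

/-- The unoriented interval lets `d < 0` cover reversed curves; for `d = 0` both sides vanish. -/
theorem speedIntegral_comp_affine (F : X → ℝ≥0∞) (g : ℝ → X) (c d a b : ℝ) :
    speedIntegral F (fun r => g (c + d * r)) a b = speedIntegral F g (c + d * a) (c + d * b) := by
  rcases eq_or_ne d 0 with rfl | hd
  · simp [speedIntegral, mspeed_const]
  have him : (fun r : ℝ => c + d * r) '' uIcc a b = uIcc (c + d * a) (c + d * b) := by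
    rw [← image_const_add_uIcc, ← image_const_mul_uIcc, image_image]
  rw [speedIntegral, speedIntegral, ← him,
    lintegral_image_eq_lintegral_abs_deriv_mul (f' := fun _ => d) measurableSet_uIcc]
  · refine lintegral_congr fun t => ?_
    rw [mspeed_comp_affine g c hd]
    ring
  · intro x _
    simpa using (((hasDerivAt_id x).const_mul d).const_add c).hasDerivWithinAt
  · intro x _ y _ h
    simpa [hd] using h

end MetricCurve

/-! ### Existence of the speed and the length formula -/

namespace MetricCurve

variable {X : Type*} [MetricSpace X]

theorem tendsto_abs_slope {φ : ℝ → ℝ} {d t : ℝ} (h : HasDerivAt φ d t) :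
    Tendsto (fun r : ℝ => |φ (t + r) - φ t| / |r|) (𝓝[≠] 0) (𝓝 |d|) := by
  have := (hasDerivAt_iff_tendsto_slope_zero.1 h).abs
  refine this.congr fun r => ?_
  rw [smul_eq_mul, abs_mul, abs_inv]
  ring

/-- Every Lipschitz map from the line into a separable metric space has a metric speed almost
everywhere, and this speed is integrated by the distance. -/
theorem exists_speed [TopologicalSpace.SeparableSpace X] {g : ℝ → X} {K : ℝ≥0}
    (hg : LipschitzWith K g) :
    ∃ v : ℝ → ℝ, Measurable v ∧ (∀ t, 0 ≤ v t) ∧ (∀ t, v t ≤ K) ∧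
      (∀ s t, s ≤ t → dist (g s) (g t) ≤ ∫ r in s..t, v r) ∧
      (∀ᵐ t, Tendsto (fun r : ℝ => dist (g (t + r)) (g t) / |r|) (𝓝[≠] 0) (𝓝 (v t))) ∧
      ∀ t, (∀ᶠ s in 𝓝 t, g s = g t) → v t = 0 := by
  have : Nonempty X := ⟨g 0⟩
  let x : ℕ → X := TopologicalSpace.denseSeq X
  let φ : ℕ → ℝ → ℝ := fun n t => dist (g t) (x n)
  have hφ : ∀ n, LipschitzWith K (φ n) := fun n => by
    have := (LipschitzWith.dist_left (x n)).comp hg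
    rwa [one_mul] at this
  -- The speed is the supremum of the slopes of the distances to a dense sequence, real functions to
  -- which Rademacher's theorem applies.
  let v : ℝ → ℝ := fun t => ⨆ n, |deriv (φ n) t|
  have hle : ∀ n t, |deriv (φ n) t| ≤ K := fun n t => norm_deriv_le_of_lipschitz (hφ n)
  have hbdd : ∀ t, BddAbove (range fun n => |deriv (φ n) t|) := fun t =>
    ⟨K, by rintro _ ⟨n, rfl⟩; exact hle n t⟩
  have hvm : Measurable v := by
    refine Measurable.iSup fun n => ?_
    exact continuous_abs.measurable.comp (measurable_deriv _)
  have hv0 : ∀ t, 0 ≤ v t := fun t => Real.iSup_nonneg fun n => abs_nonneg _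
  have hvK : ∀ t, v t ≤ K := fun t => ciSup_le fun n => hle n t
  have hvl : LocallyIntegrable v := by
    refine LocallyIntegrable.mono (locallyIntegrable_const (K : ℝ)) hvm.aestronglyMeasurable ?_
    refine Eventually.of_forall fun t => ?_
    rw [Real.norm_of_nonneg (hv0 t)]
    exact (hvK t).trans (le_abs_self _)
  have hvi : ∀ s t, IntervalIntegrable v volume s t := fun s t =>
    (hvl.integrableOn_isCompact isCompact_uIcc).intervalIntegrable
  have hdist : ∀ s t, s ≤ t → dist (g s) (g t) ≤ ∫ r in s..t, v r := by
    intro s t hst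
    have h1 : ∀ n, |φ n t - φ n s| ≤ ∫ r in s..t, v r := by
      intro n
      have hac : AbsolutelyContinuousOnInterval (φ n) s t :=
        (hφ n).lipschitzOnWith.absolutelyContinuousOnInterval
      rw [← hac.integral_deriv_eq_sub]
      refine (intervalIntegral.abs_integral_le_integral_abs hst).trans ?_
      refine intervalIntegral.integral_mono_on hst hac.intervalIntegrable_deriv.abs (hvi s t) ?_
      intro r _
      exact le_ciSup (hbdd r) n
    -- For `x n` close to `g s`, the increment of `φ n` is nearly the full distance `dist (g s) (g
    -- t)`.
    refine le_of_forall_pos_le_add fun ε hε => ?_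
    obtain ⟨n, hn⟩ := (TopologicalSpace.denseRange_denseSeq X).exists_dist_lt (g s)
      (half_pos hε)
    have h2 := h1 n
    have h3 := dist_triangle (g s) (x n) (g t)
    have h4 := le_abs_self (φ n t - φ n s)
    change dist (g s) (x n) < ε / 2 at hn
    simp only [φ] at h2 h4
    rw [dist_comm (x n)] at h3
    linarith
  refine ⟨v, hvm, hv0, hvK, hdist, ?_, ?_⟩
  · have hd : ∀ᵐ t, ∀ n, DifferentiableAt ℝ (φ n) t :=
      ae_all_iff.2 fun n => (hφ n).ae_differentiableAt
    filter_upwards [hd, _root_.LocallyIntegrable.ae_hasDerivAt_integral hvl] with t ht hvt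
    have h1 := tendsto_abs_slope (hvt 0)
    rw [abs_of_nonneg (hv0 t)] at h1
    -- Lower bound: each `φ n` changes by at most the distance. Upper bound: `hdist` and Lebesgue
    -- differentiation of `∫ v`.
    refine tendsto_order.2 ⟨fun a ha => ?_, fun a ha => ?_⟩
    · obtain ⟨n, hn⟩ := exists_lt_of_lt_ciSup ha
      filter_upwards [(tendsto_abs_slope (ht n).hasDerivAt).eventually (lt_mem_nhds hn)] with r hr
      refine hr.trans_le ?_
      gcongr
      exact abs_dist_sub_le _ _ _
    · filter_upwards [h1.eventually (gt_mem_nhds ha)] with r hr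
      refine lt_of_le_of_lt ?_ hr
      gcongr
      rw [intervalIntegral.integral_interval_sub_left (hvi _ _) (hvi _ _)]
      rcases le_total 0 r with h | h
      · rw [dist_comm]
        exact (hdist _ _ (by linarith)).trans (le_abs_self _)
      · rw [intervalIntegral.integral_symm, abs_neg]
        exact (hdist _ _ (by linarith)).trans (le_abs_self _)
  · intro t ht
    have : ∀ n, deriv (φ n) t = 0 := by
      intro n
      have : φ n =ᶠ[𝓝 t] fun _ => φ n t := by
        filter_upwards [ht] with s hs
        simp only [φ, hs]
      rw [this.deriv_eq, deriv_const]
    simp [v, this]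

theorem mspeed_eq_ofReal {g : ℝ → X} {t c : ℝ}
    (h : Tendsto (fun r : ℝ => dist (g (t + r)) (g t) / |r|) (𝓝[≠] 0) (𝓝 c)) :
    mspeed g t = ENNReal.ofReal c := by
  apply mspeed_eq_of_tendsto
  refine ((ENNReal.continuous_ofReal.tendsto c).comp h).congr' ?_
  filter_upwards [self_mem_nhdsWithin] with r hr
  simp only [Function.comp]
  rw [ENNReal.ofReal_div_of_pos (abs_pos.2 hr), edist_dist]

theorem aemeasurable_mspeed [TopologicalSpace.SeparableSpace X] {g : ℝ → X} {K : ℝ≥0}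
    (hg : LipschitzWith K g) : AEMeasurable (mspeed g) := by
  obtain ⟨v, hvm, -, -, -, hv, -⟩ := exists_speed hg
  refine ⟨fun t => ENNReal.ofReal (v t), hvm.ennreal_ofReal, ?_⟩
  filter_upwards [hv] with t ht using mspeed_eq_ofReal ht

theorem eq_of_mspeed_eq_zero [TopologicalSpace.SeparableSpace X] {g : ℝ → X}
    {K : ℝ≥0} (hg : LipschitzWith K g) {s t : ℝ} (hst : s ≤ t)
    (h : ∀ᵐ r, r ∈ Icc s t → mspeed g r = 0) : g s = g t := by
  obtain ⟨v, hvm, hv0, -, hd, hv, -⟩ := exists_speed hg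
  have : ∫ r in s..t, v r = 0 := by
    refine intervalIntegral.integral_zero_ae ?_
    filter_upwards [hv, h] with r hr hr' hrst
    rw [uIoc_of_le hst] at hrst
    have := hr' (Ioc_subset_Icc_self hrst)
    rw [mspeed_eq_ofReal hr, ENNReal.ofReal_eq_zero] at this
    exact le_antisymm this (hv0 r)
  exact dist_le_zero.1 ((hd s t hst).trans this.le)

/-- The length of a map whose increments are bounded by the integral of its metric speed. -/
theorem eVariationOn_eq_ofReal_integral {g : ℝ → X} {K : ℝ≥0} {v : ℝ → ℝ}
    (hvm : Measurable v) (hv0 : ∀ t, 0 ≤ v t) (hvK : ∀ t, v t ≤ K)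
    (hd : ∀ s t, s ≤ t → dist (g s) (g t) ≤ ∫ r in s..t, v r)
    (hv : ∀ᵐ t, Tendsto (fun r : ℝ => dist (g (t + r)) (g t) / |r|) (𝓝[≠] 0) (𝓝 (v t)))
    {a b : ℝ} (hab : a ≤ b) :
    eVariationOn g (Icc a b) = ENNReal.ofReal (∫ r in a..b, v r) := by
  have hvi : ∀ s t, IntervalIntegrable v volume s t := fun s t => by
    refine (intervalIntegrable_const (c := (K : ℝ))).mono_fun hvm.aestronglyMeasurable ?_
    refine Eventually.of_forall fun t => ?_
    change ‖v t‖ ≤ ‖(K : ℝ)‖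
    rw [Real.norm_of_nonneg (hv0 t)]
    exact (hvK t).trans (le_abs_self _)
  have hub : ∀ {c e : ℝ}, c ≤ e →
      eVariationOn g (Icc c e) ≤ ENNReal.ofReal (∫ r in c..e, v r) := by
    intro c e hce
    refine iSup_le fun ⟨n, u, hu, us⟩ => ?_
    calc ∑ i ∈ Finset.range n, edist (g (u (i + 1))) (g (u i))
        ≤ ∑ i ∈ Finset.range n, ENNReal.ofReal (∫ r in (u i)..(u (i + 1)), v r) := by
          refine Finset.sum_le_sum fun i _ => ?_
          rw [edist_comm, edist_dist]
          exact ENNReal.ofReal_le_ofReal (hd _ _ (hu (Nat.le_succ i)))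
      _ = ENNReal.ofReal (∫ r in (u 0)..(u n), v r) := by
          rw [← ENNReal.ofReal_sum_of_nonneg, intervalIntegral.sum_integral_adjacent_intervals]
          · exact fun k _ => hvi _ _
          · exact fun i _ => intervalIntegral.integral_nonneg (hu (Nat.le_succ i)) fun r _ => hv0 r
      _ ≤ _ := by
          refine ENNReal.ofReal_le_ofReal ?_
          exact intervalIntegral.integral_mono_interval (us 0).1 (hu (Nat.zero_le n)) (us n).2
            (Eventually.of_forall hv0) (hvi _ _)
  refine le_antisymm (hub hab) ?_
  -- For the lower bound, the length function `L` is Lipschitz and its increments dominate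
  -- distances, so `L' ≥ v` a.e.; integrating gives the claim.
  let L : ℝ → ℝ := fun t => (eVariationOn g (Icc a t)).toReal
  have hfin : ∀ {c e : ℝ}, c ≤ e → eVariationOn g (Icc c e) ≠ ∞ := fun h =>
    ne_top_of_le_ne_top ENNReal.ofReal_ne_top (hub h)
  have hadd : ∀ {s t : ℝ}, a ≤ s → s ≤ t → L t - L s = (eVariationOn g (Icc s t)).toReal := by
    intro s t has hst
    have := eVariationOn.Icc_add_Icc g (s := univ) has hst (mem_univ s)
    simp only [univ_inter] at this
    simp only [L]
    rw [← this, ENNReal.toReal_add (hfin has) (hfin hst)]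
    ring
  have hlow : ∀ {s t : ℝ}, a ≤ s → s ≤ t → dist (g s) (g t) ≤ L t - L s := by
    intro s t has hst
    rw [hadd has hst, dist_edist]
    exact ENNReal.toReal_mono (hfin hst)
      (eVariationOn.edist_le g (left_mem_Icc.2 hst) (right_mem_Icc.2 hst))
  have hup : ∀ {s t : ℝ}, a ≤ s → s ≤ t → L t - L s ≤ K * (t - s) := by
    intro s t has hst
    rw [hadd has hst]
    refine ENNReal.toReal_le_of_le_ofReal (by have := K.2; nlinarith) ((hub hst).trans ?_)
    refine ENNReal.ofReal_le_ofReal ?_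
    calc ∫ r in s..t, v r ≤ ∫ r in s..t, (K : ℝ) :=
          intervalIntegral.integral_mono_on hst (hvi s t) intervalIntegrable_const
            fun r _ => hvK r
      _ = K * (t - s) := by simp [mul_comm]
  have hLip : LipschitzOnWith K L (uIcc a b) := by
    rw [uIcc_of_le hab]
    refine LipschitzOnWith.of_dist_le_mul fun s hs t ht => ?_
    wlog hst : s ≤ t generalizing s t
    · rw [dist_comm, dist_comm s]
      exact this t ht s hs (le_of_not_ge hst)
    rw [dist_comm, dist_comm s, Real.dist_eq, Real.dist_eq, abs_of_nonneg (sub_nonneg.2 hst),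
      abs_of_nonneg (dist_nonneg.trans (hlow hs.1 hst))]
    exact hup hs.1 hst
  have hac := hLip.absolutelyContinuousOnInterval
  have hL0 : L a = 0 := by
    simp [L, eVariationOn.subsingleton]
  have h1 : ∫ r in a..b, v r ≤ L b := by
    rw [← sub_zero (L b), ← hL0, ← hac.integral_deriv_eq_sub]
    refine intervalIntegral.integral_mono_ae_restrict hab (hvi a b)
      hac.intervalIntegrable_deriv ?_
    rw [← restrict_Ioo_eq_restrict_Icc, EventuallyLE, ae_restrict_iff' measurableSet_Ioo]
    filter_upwards [hac.ae_differentiableAt, hv] with t htd htv ht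
    have hLt := (htd (by rw [uIcc_of_le hab]; exact Ioo_subset_Icc_self ht)).hasDerivAt
    have hmono : 𝓝[>] (0 : ℝ) ≤ 𝓝[≠] 0 := nhdsWithin_mono 0 fun r hr => ne_of_gt hr
    refine le_of_tendsto_of_tendsto (htv.mono_left hmono)
      ((hasDerivAt_iff_tendsto_slope_zero.1 hLt).mono_left hmono) ?_
    filter_upwards [self_mem_nhdsWithin] with r hr
    have hr' : 0 < r := hr
    rw [abs_of_pos hr', smul_eq_mul, div_eq_inv_mul, dist_comm]
    gcongr
    exact hlow ht.1.le (by linarith)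
  exact (ENNReal.ofReal_le_ofReal h1).trans (ENNReal.ofReal_toReal (hfin hab)).le

end MetricCurve

/-! ### Path integrals along Lipschitz curves -/

namespace MetricCurve

variable {X : Type*} [MetricSpace X]

theorem LipCurves.exists_lipschitzWith {γ : Curve X} (hγ : γ ∈ LipCurves X) :
    ∃ K : ℝ≥0, LipschitzWith K γ := by
  obtain ⟨h0, h1, K, hK⟩ := hγ
  obtain ⟨a, b, hab, φ⟩ := γ
  obtain rfl : a = 0 := h0
  obtain rfl : b = 1 := h1
  refine ⟨K, ?_⟩
  have hφ : LipschitzWith K φ := by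
    intro s t
    have := hK s.2 t.2
    simp only [IccExtend_val] at this
    exact this
  have := hφ.comp (LipschitzWith.projIcc hab.le)
  rwa [mul_one] at this

theorem Curve.eq_left (γ : Curve X) {t : ℝ} (ht : t ≤ γ.a) : γ t = γ γ.a := by
  simp only [IccExtend_of_le_left γ.a_lt_b.le γ.toMap ht, IccExtend_left]

theorem Curve.eq_right (γ : Curve X) {t : ℝ} (ht : γ.b ≤ t) : γ t = γ γ.b := by
  simp only [IccExtend_of_right_le γ.a_lt_b.le γ.toMap ht, IccExtend_right]

/-- The path integral along a Lipschitz curve is the integral against its metric speed. -/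
theorem pathIntegral_eq_speedIntegral [TopologicalSpace.SeparableSpace X] [MeasurableSpace X]
    [BorelSpace X] {γ : Curve X} (hγ : γ ∈ LipCurves X) {F : X → ℝ≥0∞} (hF : Measurable F) :
    pathIntegral γ F = speedIntegral F γ 0 1 := by
  obtain ⟨K, hK⟩ := LipCurves.exists_lipschitzWith hγ
  obtain ⟨h0, h1, -⟩ := hγ
  obtain ⟨a, b, hab, φ⟩ := γ
  obtain rfl : a = 0 := h0
  obtain rfl : b = 1 := h1
  set γ : Curve X := ⟨0, 1, hab, φ⟩
  obtain ⟨v, hvm, hv0, hvK, hd, hv, hvz⟩ := exists_speed hK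
  have hvar : ∀ {a b : ℝ}, a ≤ b →
      eVariationOn γ (Icc a b) = ENNReal.ofReal (∫ r in a..b, v r) := fun h =>
    eVariationOn_eq_ofReal_integral hvm hv0 hvK hd hv h
  have hrect : Rectifiable γ := by
    rw [Rectifiable, hvar γ.a_lt_b.le]
    exact ENNReal.ofReal_ne_top
  have hvi : ∀ s t, IntervalIntegrable v volume s t := fun s t => by
    refine (intervalIntegrable_const (c := (K : ℝ))).mono_fun hvm.aestronglyMeasurable ?_
    refine Eventually.of_forall fun t => ?_
    change ‖v t‖ ≤ ‖(K : ℝ)‖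
    rw [Real.norm_of_nonneg (hv0 t)]
    exact (hvK t).trans (le_abs_self _)
  -- The constant extension makes `v` vanish off `[0,1]`, so the truncated length is the primitive
  -- of `v` on the whole line.
  have hvneg : ∀ t < 0, v t = 0 := fun t ht => hvz t <| by
    filter_upwards [Iio_mem_nhds ht] with s hs
    rw [γ.eq_left (le_of_lt hs), γ.eq_left ht.le]
  have hvpos : ∀ t, 1 < t → v t = 0 := fun t ht => hvz t <| by
    filter_upwards [Ioi_mem_nhds ht] with s hs
    rw [γ.eq_right (le_of_lt hs), γ.eq_right ht.le]
  have hL : ∀ t, (lengthUpTo γ t).toReal = ∫ r in (0 : ℝ)..t, v r := by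
    intro t
    change (eVariationOn γ (Icc 0 (min t 1))).toReal = _
    rcases lt_or_ge t 0 with ht | ht
    · rw [eVariationOn.subsingleton _ (by rw [Icc_eq_empty (by simp [ht])]; simp),
        intervalIntegral.integral_symm,
        intervalIntegral.integral_of_le ht.le, integral_Ioc_eq_integral_Ioo,
        setIntegral_eq_zero_of_forall_eq_zero fun r hr => hvneg r hr.2]
      simp
    rw [hvar (le_min ht zero_le_one), ENNReal.toReal_ofReal
      (intervalIntegral.integral_nonneg (le_min ht zero_le_one) fun r _ => hv0 r)]
    rcases le_total t 1 with ht1 | ht1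
    · rw [min_eq_left ht1]
    · rw [min_eq_right ht1, ← intervalIntegral.integral_add_adjacent_intervals (hvi 0 1) (hvi 1 t),
        intervalIntegral.integral_of_le ht1,
        setIntegral_eq_zero_of_forall_eq_zero fun r hr => hvpos r hr.1, add_zero]
  have hLc : Continuous fun t => (lengthUpTo γ t).toReal := by
    simp only [hL]
    exact intervalIntegral.continuous_primitive hvi 0
  -- Continuity of the length function removes the right limits in the Stieltjes measure, leaving
  -- density `v`.
  have hmeas : hrect.monotone_lengthUpTo.stieltjesFunction.measure =
      volume.withDensity fun t => ENNReal.ofReal (v t) := by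
    refine Measure.ext_of_Ioc _ _ fun a b hab => ?_
    rw [StieltjesFunction.measure_Ioc, Monotone.stieltjesFunction_eq,
      Monotone.stieltjesFunction_eq, (hLc.continuousAt.continuousWithinAt).rightLim_eq,
      (hLc.continuousAt.continuousWithinAt).rightLim_eq, hL, hL,
      intervalIntegral.integral_interval_sub_left (hvi _ _) (hvi _ _),
      withDensity_apply _ measurableSet_Ioc, intervalIntegral.integral_of_le hab.le,
      ofReal_integral_eq_lintegral_ofReal (hvi a b).1 (Eventually.of_forall hv0)]
  have hFm : Measurable fun t => F (γ t) := hF.comp hK.continuous.measurable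
  rw [pathIntegral, dif_pos hrect, variationMeasure, hmeas]
  change ∫⁻ t in Icc 0 1, F (γ t) ∂_ = _
  rw [speedIntegral,
    uIcc_of_le zero_le_one, restrict_withDensity measurableSet_Icc,
    lintegral_withDensity_eq_lintegral_mul _ hvm.ennreal_ofReal hFm]
  refine lintegral_congr_ae (ae_restrict_of_ae ?_)
  filter_upwards [hv] with t ht
  rw [Pi.mul_apply, mul_comm, mspeed_eq_ofReal ht]

/-- The restriction to `[0, 1]` of a continuous map on the line. -/
noncomputable def unitCurve (g : ℝ → X) (hg : Continuous g) : Curve X where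
  a := 0
  b := 1
  a_lt_b := zero_lt_one
  toMap := ⟨fun t => g t, hg.comp continuous_subtype_val⟩

theorem unitCurve_apply (g : ℝ → X) (hg : Continuous g) {t : ℝ} (ht : t ∈ Icc (0 : ℝ) 1) :
    unitCurve g hg t = g t :=
  IccExtend_of_mem zero_le_one (unitCurve g hg).toMap ht

theorem unitCurve_mem_LipCurves {g : ℝ → X} {K : ℝ≥0} (hg : LipschitzWith K g) :
    unitCurve g hg.continuous ∈ LipCurves X := by
  refine ⟨rfl, rfl, K, fun s hs t ht => ?_⟩
  rw [unitCurve_apply g _ hs, unitCurve_apply g _ ht]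
  exact hg s t

theorem pathIntegral_unitCurve [TopologicalSpace.SeparableSpace X] [MeasurableSpace X]
    [BorelSpace X] {g : ℝ → X} {K : ℝ≥0} (hg : LipschitzWith K g) {F : X → ℝ≥0∞}
    (hF : Measurable F) :
    pathIntegral (unitCurve g hg.continuous) F = speedIntegral F g 0 1 := by
  rw [pathIntegral_eq_speedIntegral (unitCurve_mem_LipCurves hg) hF]
  refine speedIntegral_congr F fun t ht => unitCurve_apply g _ ?_
  rwa [uIcc_of_le zero_le_one] at ht

theorem LipCurves_subset_ACCurves (q : ℝ≥0∞) : LipCurves X ⊆ ACCurves X q := by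
  rintro γ ⟨h0, h1, K, hK⟩
  refine ⟨h0, h1, fun _ => K, fun _ => K.2, memLp_const _, fun s hs t ht hst => ?_⟩
  have := hK.dist_le_mul s hs t ht
  rw [dist_comm s, Real.dist_eq, abs_of_pos (sub_pos.2 hst)] at this
  simpa [mul_comm] using this

end MetricCurve

/-! ### Gluing curves and the representative -/

namespace MetricCurve

variable {X : Type*} [MetricSpace X]

/-- Concatenation at `0` of two Lipschitz maps. -/
theorem lipschitzWith_ite_le_zero {g₁ g₂ : ℝ → X} {K : ℝ≥0} (h₁ : LipschitzWith K g₁)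
    (h₂ : LipschitzWith K g₂) (h : g₁ 0 = g₂ 0) :
    LipschitzWith K fun r => if r ≤ 0 then g₁ r else g₂ r := by
  refine LipschitzWith.of_dist_le_mul fun s t => ?_
  wlog hst : s ≤ t generalizing s t
  · rw [dist_comm, dist_comm s]
    exact this t s (le_of_not_ge hst)
  by_cases hs : s ≤ 0 <;> by_cases ht : t ≤ 0
  · simpa [hs, ht] using h₁.dist_le_mul s t
  · simp only [hs, ht, if_true, if_false]
    have e1 := h₁.dist_le_mul s 0
    have e2 := h₂.dist_le_mul 0 t
    have e3 := dist_triangle (g₁ s) (g₁ 0) (g₂ t)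
    rw [← h] at e2
    rw [Real.dist_eq, abs_of_nonpos (by linarith)] at e1 e2
    rw [Real.dist_eq, abs_of_nonpos (by linarith)]
    linarith
  · exact absurd (hst.trans ht) hs
  · simpa [hs, ht] using h₂.dist_le_mul s t

variable [TopologicalSpace.SeparableSpace X] [MeasurableSpace X] [BorelSpace X]

/-- `k` is infinite along every curve of `badCurves`, end points included. -/
def Obstructs (k : X → ℝ≥0∞) (q : ℝ≥0∞) (f : X → ℝ) (ρ : X → ℝ≥0∞) : Prop :=
  ∀ γ ∈ badCurves q f ρ, k (γ 0) + k (γ 1) + pathIntegral γ k = ∞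

/-- Otherwise the curve, rescaled to `[0,1]`, would be bad, and one of the three finite quantities
would have to be infinite. -/
theorem Obstructs.abs_sub_le_speedIntegral {k ρ : X → ℝ≥0∞} {q : ℝ≥0∞} {f : X → ℝ} (hk : Obstructs k q f ρ)
    (hkm : Measurable k) (hρ : Measurable ρ) {g : ℝ → X} {K : ℝ≥0} (hg : LipschitzWith K g)
    {a b : ℝ} (ha : k (g a) ≠ ∞) (hb : k (g b) ≠ ∞) (hab : speedIntegral k g a b ≠ ∞) :
    ENNReal.ofReal |f (g b) - f (g a)| ≤ speedIntegral ρ g a b := by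
  by_contra! hlt
  let σ : ℝ → X := fun r => g (a + (b - a) * r)
  have hσ : LipschitzWith (K * ‖b - a‖₊) σ := by
    refine hg.comp (LipschitzWith.of_dist_le_mul fun s t => ?_)
    rw [Real.dist_eq, Real.dist_eq, coe_nnnorm, Real.norm_eq_abs, ← abs_mul]
    exact (congrArg abs (by ring)).le
  have hI : ∀ F : X → ℝ≥0∞, speedIntegral F σ 0 1 = speedIntegral F g a b := fun F => by
    have := speedIntegral_comp_affine F g a (b - a) 0 1
    simpa using this
  have h0 : unitCurve σ hσ.continuous 0 = g a := by
    rw [unitCurve_apply σ _ (by simp)]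
    simp [σ]
  have h1 : unitCurve σ hσ.continuous 1 = g b := by
    rw [unitCurve_apply σ _ (by simp)]
    simp [σ]
  have := hk (unitCurve σ hσ.continuous)
    ⟨LipCurves_subset_ACCurves q (unitCurve_mem_LipCurves hσ), by
      rwa [pathIntegral_unitCurve hσ hρ, hI, h0, h1]⟩
  rw [pathIntegral_unitCurve hσ hkm, hI, h0, h1] at this
  exact (ENNReal.add_ne_top.2 ⟨ENNReal.add_ne_top.2 ⟨ha, hb⟩, hab⟩) this

/-- The first curve is run backwards to the common point and the second forwards from it. That point
is interior to the glued curve, so `k` may be infinite there. -/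
theorem Obstructs.abs_sub_le_add {k ρ : X → ℝ≥0∞} {q : ℝ≥0∞} {f : X → ℝ} (hk : Obstructs k q f ρ)
    (hkm : Measurable k) (hρ : Measurable ρ) {g₁ g₂ : ℝ → X} {K₁ K₂ : ℝ≥0}
    (hg₁ : LipschitzWith K₁ g₁) (hg₂ : LipschitzWith K₂ g₂) {a₁ a₂ b₁ b₂ : ℝ}
    (ha : g₁ a₁ = g₂ a₂) (hb₁ : k (g₁ b₁) ≠ ∞) (hb₂ : k (g₂ b₂) ≠ ∞)
    (h₁ : speedIntegral k g₁ a₁ b₁ ≠ ∞) (h₂ : speedIntegral k g₂ a₂ b₂ ≠ ∞) :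
    ENNReal.ofReal |f (g₂ b₂) - f (g₁ b₁)| ≤
      speedIntegral ρ g₁ a₁ b₁ + speedIntegral ρ g₂ a₂ b₂ := by
  have hlip : ∀ {g : ℝ → X} {K : ℝ≥0} (c d : ℝ), LipschitzWith K g →
      LipschitzWith (K * ‖d‖₊) fun r => g (c + d * r) := by
    intro g K c d hg
    refine hg.comp (LipschitzWith.of_dist_le_mul fun s t => ?_)
    rw [Real.dist_eq, Real.dist_eq, coe_nnnorm, Real.norm_eq_abs, ← abs_mul]
    exact (congrArg abs (by ring)).le
  let e₁ : ℝ → X := fun r => g₁ (a₁ + (a₁ - b₁) * r)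
  let e₂ : ℝ → X := fun r => g₂ (a₂ + (b₂ - a₂) * r)
  let σ : ℝ → X := fun r => if r ≤ 0 then e₁ r else e₂ r
  have he : e₁ 0 = e₂ 0 := by simp [e₁, e₂, ha]
  have hσ := lipschitzWith_ite_le_zero
    ((hlip a₁ (a₁ - b₁) hg₁).weaken (le_max_left _ (K₂ * ‖b₂ - a₂‖₊)))
    ((hlip a₂ (b₂ - a₂) hg₂).weaken (le_max_right (K₁ * ‖a₁ - b₁‖₊) _)) he
  have hσ₁ : EqOn σ e₁ (uIcc (-1) 0) := fun r hr => by
    rw [uIcc_of_le (by norm_num)] at hr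
    exact if_pos hr.2
  have hσ₂ : EqOn σ e₂ (uIcc 0 1) := fun r hr => by
    rw [uIcc_of_le (by norm_num)] at hr
    rcases hr.1.eq_or_lt with rfl | h
    · rw [← he]
      exact if_pos le_rfl
    · exact if_neg (not_le.2 h)
  have hI : ∀ F : X → ℝ≥0∞,
      speedIntegral F σ (-1) 1 = speedIntegral F g₁ a₁ b₁ + speedIntegral F g₂ a₂ b₂ := by
    intro F
    rw [← speedIntegral_add F σ (b := 0) (by norm_num) (by norm_num), speedIntegral_congr F hσ₁,
      speedIntegral_congr F hσ₂, speedIntegral_comp_affine F g₁ a₁ (a₁ - b₁),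
      speedIntegral_comp_affine F g₂ a₂ (b₂ - a₂), speedIntegral_symm F g₁]
    simp
  have hm : σ (-1) = g₁ b₁ := by
    rw [hσ₁ (by simp)]
    simp [e₁]
  have hp : σ 1 = g₂ b₂ := by
    rw [hσ₂ (by simp)]
    simp [e₂]
  have := hk.abs_sub_le_speedIntegral hkm hρ hσ (a := -1) (b := 1)
  rw [show (if (-1 : ℝ) ≤ 0 then e₁ (-1) else e₂ (-1)) = g₁ b₁ from hm,
    show (if (1 : ℝ) ≤ 0 then e₁ 1 else e₂ 1) = g₂ b₂ from hp] at this
  rw [← hI]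
  refine this hb₁ hb₂ ?_
  change speedIntegral k σ (-1) 1 ≠ ∞
  rw [hI]
  exact ENNReal.add_ne_top.2 ⟨h₁, h₂⟩

/-- The lower bounds for a value at `x` given by the values of `f` at the points reached from `x`
along Lipschitz curves on which `k` is integrable. -/
def lowerValues (k : X → ℝ≥0∞) (f : X → ℝ) (ρ : X → ℝ≥0∞) (x : X) : Set ℝ :=
  {r | ∃ (g : ℝ → X) (K : ℝ≥0) (a b : ℝ), LipschitzWith K g ∧ g a = x ∧ k (g b) ≠ ∞ ∧
    speedIntegral k g a b ≠ ∞ ∧ r = f (g b) - (speedIntegral ρ g a b).toReal}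

/-- The representative of `f`. -/
noncomputable def goodRep (k : X → ℝ≥0∞) (f : X → ℝ) (ρ : X → ℝ≥0∞) (x : X) : ℝ :=
  sSup (lowerValues k f ρ x)

/-- The given curve supplies a lower value, and gluing it to any competitor supplies an upper bound.
So `sSup` is a true supremum here; its default `0` occurs only where no competitor starts. -/
theorem Obstructs.abs_goodRep_sub_le {k ρ : X → ℝ≥0∞} {q : ℝ≥0∞} {f : X → ℝ}
    (hk : Obstructs k q f ρ) (hkm : Measurable k) (hρ : Measurable ρ) (hρk : ρ ≤ k) {g : ℝ → X}
    {K : ℝ≥0} (hg : LipschitzWith K g) {a b : ℝ} (hb : k (g b) ≠ ∞)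
    (hab : speedIntegral k g a b ≠ ∞) :
    ENNReal.ofReal |goodRep k f ρ (g a) - f (g b)| ≤ speedIntegral ρ g a b := by
  have hfin : ∀ {g : ℝ → X} {a b : ℝ}, speedIntegral k g a b ≠ ∞ → speedIntegral ρ g a b ≠ ∞ :=
    fun h => ne_top_of_le_ne_top h (speedIntegral_mono hρk _ _ _)
  have hub : f (g b) + (speedIntegral ρ g a b).toReal ∈
      upperBounds (lowerValues k f ρ (g a)) := by
    rintro _ ⟨g', K', a', b', hg', ha', hb', hab', rfl⟩
    have := hk.abs_sub_le_add hkm hρ hg hg' ha'.symm hb hb' hab hab'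
    rw [← ENNReal.ofReal_toReal (hfin hab), ← ENNReal.ofReal_toReal (hfin hab'),
      ← ENNReal.ofReal_add ENNReal.toReal_nonneg ENNReal.toReal_nonneg,
      ENNReal.ofReal_le_ofReal_iff (by positivity)] at this
    have := (le_abs_self _).trans this
    linarith
  have hmem : f (g b) - (speedIntegral ρ g a b).toReal ∈ lowerValues k f ρ (g a) :=
    ⟨g, K, a, b, hg, rfl, hb, hab, rfl⟩
  refine ENNReal.ofReal_le_of_le_toReal (abs_le.2 ⟨?_, ?_⟩)
  · have := le_csSup ⟨_, hub⟩ hmem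
    rw [goodRep]
    linarith
  · have := csSup_le ⟨_, hmem⟩ hub
    rw [goodRep]
    linarith

theorem Obstructs.goodRep_eq {k ρ : X → ℝ≥0∞} {q : ℝ≥0∞} {f : X → ℝ}
    (hk : Obstructs k q f ρ) (hkm : Measurable k) (hρ : Measurable ρ) (hρk : ρ ≤ k) {x : X}
    (hx : k x ≠ ∞) : goodRep k f ρ x = f x := by
  have := hk.abs_goodRep_sub_le hkm hρ hρk (LipschitzWith.const x) (a := 0) (b := 0) hx
    (by simp [speedIntegral_self])
  rw [speedIntegral_self, nonpos_iff_eq_zero, ENNReal.ofReal_eq_zero] at this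
  exact sub_eq_zero.1 (abs_nonpos_iff.1 this)

/-- Along a Lipschitz curve on which `k` is integrable, `ρ` is an upper gradient of the
representative. -/
theorem Obstructs.abs_goodRep_sub_goodRep_le {k ρ : X → ℝ≥0∞} {q : ℝ≥0∞} {f : X → ℝ}
    (hk : Obstructs k q f ρ) (hkm : Measurable k) (hρ : Measurable ρ) (hρk : ρ ≤ k) {g : ℝ → X}
    {K : ℝ≥0} (hg : LipschitzWith K g) {s t : ℝ} (hst : speedIntegral k g s t ≠ ∞) :
    ENNReal.ofReal |goodRep k f ρ (g s) - goodRep k f ρ (g t)| ≤ speedIntegral ρ g s t := by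
  wlog h : s ≤ t generalizing s t
  · rw [abs_sub_comm, speedIntegral_symm]
    exact this (by rwa [speedIntegral_symm]) (le_of_not_ge h)
  -- Both endpoints may have `k = ∞`; one intermediate point with `k` finite suffices.
  by_cases hr : ∃ r ∈ Icc s t, k (g r) ≠ ∞
  · obtain ⟨r, hr, hkr⟩ := hr
    have hadd := speedIntegral_add ρ g hr.1 hr.2
    have hadd' := speedIntegral_add k g hr.1 hr.2
    rw [← hadd', ENNReal.add_ne_top] at hst
    have e1 := hk.abs_goodRep_sub_le hkm hρ hρk hg hkr hst.1
    have e2 := hk.abs_goodRep_sub_le hkm hρ hρk hg (a := t) hkr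
      (by rw [speedIntegral_symm]; exact hst.2)
    rw [speedIntegral_symm ρ g t] at e2
    rw [← hadd]
    refine le_trans ?_ (add_le_add e1 e2)
    rw [← ENNReal.ofReal_add (abs_nonneg _) (abs_nonneg _)]
    refine ENNReal.ofReal_le_ofReal ?_
    rw [abs_sub_comm (goodRep k f ρ (g t))]
    exact abs_sub_le _ _ _
  -- With `k = ∞` on all of `[s,t]`, integrability forces zero speed a.e., so the endpoints
  -- coincide.
  · push Not at hr
    have : g s = g t := by
      refine eq_of_mspeed_eq_zero hg h ?_
      rw [← ae_restrict_iff' measurableSet_Icc]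
      have hm : AEMeasurable (fun r => k (g r) * mspeed g r) (volume.restrict (Icc s t)) :=
        ((hkm.comp hg.continuous.measurable).aemeasurable.mul
          (aemeasurable_mspeed hg)).restrict
      rw [speedIntegral, uIcc_of_le h] at hst
      filter_upwards [ae_lt_top' hm hst, ae_restrict_mem measurableSet_Icc] with r h1 h2
      simp only [hr r h2] at h1
      by_contra h3
      rw [ENNReal.top_mul h3] at h1
      exact lt_irrefl _ h1
    simp [this]

end MetricCurve

/-! ### Absolute continuity on the line -/

namespace MetricCurve

theorem absolutelyContinuousOnInterval_of_dist_le {f Ψ : ℝ → ℝ} {a b : ℝ}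
    (hΨ : AbsolutelyContinuousOnInterval Ψ a b)
    (h : ∀ x ∈ uIcc a b, ∀ y ∈ uIcc a b, dist (f x) (f y) ≤ dist (Ψ x) (Ψ y)) :
    AbsolutelyContinuousOnInterval f a b := by
  rw [absolutelyContinuousOnInterval_iff] at hΨ ⊢
  intro ε hε
  obtain ⟨δ, hδ, H⟩ := hΨ ε hε
  refine ⟨δ, hδ, fun E hE hlt => (Finset.sum_le_sum fun i hi => ?_).trans_lt (H E hE hlt)⟩
  exact h _ (hE.1 i hi).1 _ (hE.1 i hi).2

/-- A function whose increments are controlled by the integral of `w` is absolutely continuous and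
its derivative is bounded by `w` almost everywhere. -/
theorem absolutelyContinuous_of_sub_le_lintegral {u : ℝ → ℝ} {w : ℝ → ℝ≥0∞} {a b : ℝ} (hab : a ≤ b)
    (hw : AEMeasurable w (volume.restrict (Icc a b))) (hfin : ∫⁻ r in Icc a b, w r ≠ ∞)
    (hu : ∀ s ∈ Icc a b, ∀ t ∈ Icc a b, s ≤ t →
      ENNReal.ofReal |u s - u t| ≤ ∫⁻ r in Icc s t, w r) :
    AbsolutelyContinuousOnInterval u a b ∧
      ∀ᵐ t ∂(volume.restrict (Ioo a b)), ∃ d : ℝ, HasDerivAt u d t ∧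
        ENNReal.ofReal |d| ≤ w t ∧ w t < ∞ := by
  let W : ℝ → ℝ := fun t => (w t).toReal
  have hWi : IntegrableOn W (Icc a b) := integrable_toReal_of_lintegral_ne_top hw hfin
  have hWab : IntervalIntegrable W volume a b := by
    rw [intervalIntegrable_iff_integrableOn_Icc_of_le hab]
    exact hWi
  have hlt : ∀ᵐ t ∂(volume.restrict (Icc a b)), w t < ∞ := ae_lt_top' hw hfin
  let Ψ : ℝ → ℝ := fun t => ∫ r in a..t, W r
  have hsub : ∀ {s t}, s ∈ Icc a b → t ∈ Icc a b → Ψ t - Ψ s = ∫ r in s..t, W r := by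
    intro s t hs ht
    refine intervalIntegral.integral_interval_sub_left (hWab.mono_set ?_) (hWab.mono_set ?_)
    · exact uIcc_subset_uIcc_left (by rwa [uIcc_of_le hab])
    · exact uIcc_subset_uIcc_left (by rwa [uIcc_of_le hab])
  have hle : ∀ {s t}, s ∈ Icc a b → t ∈ Icc a b → s ≤ t → |u s - u t| ≤ Ψ t - Ψ s := by
    intro s t hs ht hst
    have hss : Icc s t ⊆ Icc a b := Icc_subset_Icc hs.1 ht.2
    have h1 := hu s hs t ht hst
    have h2 : ∫⁻ r in Icc s t, w r ≠ ∞ := ne_top_of_le_ne_top hfin (lintegral_mono_set hss)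
    rw [hsub hs ht, intervalIntegral.integral_of_le hst, ← integral_Icc_eq_integral_Ioc,
      integral_toReal (hw.mono_set hss) (ae_restrict_of_ae_restrict_of_subset hss hlt)]
    exact (ENNReal.ofReal_le_iff_le_toReal h2).1 h1
  have hle' : ∀ {s t}, s ∈ Icc a b → t ∈ Icc a b → |u s - u t| ≤ |Ψ s - Ψ t| := by
    intro s t hs ht
    rcases le_total s t with hst | hst
    · rw [abs_sub_comm (Ψ s)]
      exact (hle hs ht hst).trans (le_abs_self _)
    · rw [abs_sub_comm (u s)]
      exact (hle ht hs hst).trans (le_abs_self _)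
  have hac : AbsolutelyContinuousOnInterval u a b := by
    refine absolutelyContinuousOnInterval_of_dist_le
      (hWab.absolutelyContinuousOnInterval_intervalIntegral (c := a) (by simp)) fun x hx y hy => ?_
    rw [uIcc_of_le hab] at hx hy
    exact hle' hx hy
  refine ⟨hac, ?_⟩
  rw [← restrict_Ioo_eq_restrict_Icc, ae_restrict_iff' measurableSet_Ioo] at hlt
  rw [ae_restrict_iff' measurableSet_Ioo]
  filter_upwards [hlt, hac.ae_differentiableAt, hWab.ae_hasDerivAt_integral] with t hwt htd hΨt ht
  have htI : t ∈ uIcc a b := by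
    rw [uIcc_of_le hab]
    exact Ioo_subset_Icc_self ht
  refine ⟨deriv u t, (htd htI).hasDerivAt, ?_, hwt ht⟩
  have h1 : HasDerivAt Ψ (W t) t := hΨt htI a (by simp)
  -- Difference quotients of `u` are dominated by those of the primitive `Ψ`.
  have h2 : |deriv u t| ≤ |W t| := by
    refine le_of_tendsto_of_tendsto (tendsto_abs_slope (htd htI).hasDerivAt)
      (tendsto_abs_slope h1) ?_
    have h3 : ∀ᶠ r in 𝓝[≠] (0 : ℝ), t + r ∈ Icc a b := by
      have : Tendsto (fun r : ℝ => t + r) (𝓝 0) (𝓝 (t + 0)) :=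
        (continuous_const.add continuous_id).tendsto 0
      rw [add_zero] at this
      exact (this.mono_left nhdsWithin_le_nhds).eventually (Icc_mem_nhds ht.1 ht.2)
    filter_upwards [h3] with r hr
    exact div_le_div_of_nonneg_right (hle' hr (Ioo_subset_Icc_self ht)) (abs_nonneg r)
  rw [abs_of_nonneg ENNReal.toReal_nonneg] at h2
  exact (ENNReal.ofReal_le_iff_le_toReal (hwt ht).ne).2 h2

/-- The derivative vanishes at almost every zero of a function that is differentiable there. -/
theorem ae_hasDerivAt_zero_of_eq_zero (D : ℝ → ℝ) :
    ∀ᵐ t, D t = 0 → DifferentiableAt ℝ D t → HasDerivAt D 0 t := by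
  -- Zeros isolated from the right are countable; a nonzero derivative at a zero would isolate it.
  have hc := countable_setOfPred_isolated_right_within (s := {t : ℝ | D t = 0})
  filter_upwards [hc.ae_notMem volume] with t ht h0 hd
  by_contra hne
  have hne' : deriv D t ≠ 0 := fun h => hne (h ▸ hd.hasDerivAt)
  refine ht ⟨h0, ?_⟩
  have h1 : ∀ᶠ z in 𝓝[≠] t, D z ≠ 0 := hd.hasDerivAt.eventually_ne hne'
  rw [← empty_mem_iff_bot, mem_nhdsWithin_iff_eventually]
  filter_upwards [eventually_nhdsWithin_iff.1 h1] with z hz hz'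
  exact hz (ne_of_gt hz'.2) hz'.1

/-! ### Families of modulus zero -/

section Modulus

variable {X : Type*} [MetricSpace X]

theorem pathIntegral_mono (γ : Curve X) {F G : X → ℝ≥0∞} (h : F ≤ G) :
    pathIntegral γ F ≤ pathIntegral γ G := by
  unfold pathIntegral
  split_ifs
  · exact lintegral_mono fun t => h _
  · exact le_rfl

theorem pathIntegral_const_mul (γ : Curve X) (F : X → ℝ≥0∞) {c : ℝ≥0∞} (hc : c ≠ 0)
    (hc' : c ≠ ∞) : pathIntegral γ (fun x => c * F x) = c * pathIntegral γ F := by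
  unfold pathIntegral
  split_ifs
  · exact lintegral_const_mul' c _ hc'
  · rw [ENNReal.mul_top hc]

variable [MeasurableSpace X]

/-- Every multiple `k / (n + 1)` is still admissible, and its energy tends to zero. -/
theorem modulus_eq_zero_of_pathIntegral_eq_top {m : Measure X} {p : ℝ} (hp : 0 < p)
    {k : X → ℝ≥0∞} (hk : Measurable k) (hkp : ∫⁻ x, k x ^ p ∂m ≠ ∞) {Γ : Set (Curve X)}
    (hΓ : ∀ γ ∈ Γ, pathIntegral γ k = ∞) : modulus m p 0 Γ = 0 := by
  have hle : ∀ n : ℕ, modulus m p 0 Γ ≤ ((n + 1 : ℝ≥0∞)⁻¹) ^ p * ∫⁻ x, k x ^ p ∂m := by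
    intro n
    have hc : ((n : ℝ≥0∞) + 1)⁻¹ ≠ 0 :=
      ENNReal.inv_ne_zero.2 (ENNReal.add_ne_top.2 ⟨ENNReal.natCast_ne_top n, ENNReal.one_ne_top⟩)
    have hc' : ((n : ℝ≥0∞) + 1)⁻¹ ≠ ∞ := ENNReal.inv_ne_top.2 (by simp)
    have hadm : Admissible 0 Γ fun x => ((n : ℝ≥0∞) + 1)⁻¹ * k x := by
      refine ⟨hk.const_mul _, fun γ hγ => ?_⟩
      rw [pathIntegral_const_mul γ k hc hc', hΓ γ hγ, ENNReal.mul_top hc, add_top]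
      exact le_top
    refine (iInf₂_le _ hadm).trans ?_
    simp only [ENNReal.mul_rpow_of_nonneg _ _ hp.le]
    rw [lintegral_const_mul _ (hk.pow_const p)]
  have hlim : Tendsto (fun n : ℕ => (((n : ℝ≥0∞) + 1)⁻¹) ^ p * ∫⁻ x, k x ^ p ∂m) atTop (𝓝 0) := by
    have h1 : Tendsto (fun n : ℕ => ((n : ℝ≥0∞) + 1)⁻¹) atTop (𝓝 0) := by
      have := (tendsto_add_atTop_iff_nat 1).2 ENNReal.tendsto_inv_nat_nhds_zero
      simpa using this
    have h2 := (ENNReal.continuous_rpow_const (y := p)).tendsto 0 |>.comp h1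
    rw [ENNReal.zero_rpow_of_pos hp] at h2
    have := ENNReal.Tendsto.mul_const h2 (Or.inr hkp)
    rwa [zero_mul] at this
  exact le_antisymm (ge_of_tendsto' hlim hle) zero_le

/-- A family of modulus zero is annihilated by a single `p`-integrable function, which may be taken
above a given one. -/
theorem exists_obstructs {m : Measure X} {p : ℝ} (hp : 0 < p) {q : ℝ≥0∞} {f : X → ℝ}
    {ρ : X → ℝ≥0∞} (hρ : Measurable ρ) (hρp : ∫⁻ x, ρ x ^ p ∂m < ∞)
    (hmod : modulus m p 1 (badCurves q f ρ) = 0) :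
    ∃ k : X → ℝ≥0∞, Measurable k ∧ ρ ≤ k ∧ ∫⁻ x, k x ^ p ∂m ≠ ∞ ∧ Obstructs k q f ρ := by
  have hn : ∀ n : ℕ, ((n : ℝ≥0∞) + 1) ≠ 0 := fun n => by simp
  have hn' : ∀ n : ℕ, ((n : ℝ≥0∞) + 1) ≠ ∞ := fun n => by simp
  have hnp : ∀ n : ℕ, ((n : ℝ≥0∞) + 1) ^ p ≠ 0 := fun n => by simp [hn n, hn' n]
  have hnp' : ∀ n : ℕ, ((n : ℝ≥0∞) + 1) ^ p ≠ ∞ := fun n =>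
    ENNReal.rpow_ne_top_of_nonneg hp.le (hn' n)
  have hex : ∀ n : ℕ, ∃ σ : X → ℝ≥0∞, Admissible 1 (badCurves q f ρ) σ ∧
      ∫⁻ x, σ x ^ p ∂m < 2⁻¹ ^ n / ((n : ℝ≥0∞) + 1) ^ p := by
    intro n
    have hpos : modulus m p 1 (badCurves q f ρ) < 2⁻¹ ^ n / ((n : ℝ≥0∞) + 1) ^ p := by
      rw [hmod]
      exact ENNReal.div_pos (by simp) (hnp' n)
    simpa only [modulus, iInf_lt_iff, exists_prop] using hpos
  choose σ hσ hσp using hex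
  -- The weight `n + 1` turns admissibility of `σ n` into a bound by `n + 1`, while the energy of `S
  -- n` stays below `2⁻ⁿ`. Taking a supremum instead of a sum lets `p`-th powers be bounded
  -- termwise.
  let S : ℕ → X → ℝ≥0∞ := fun n x => ((n : ℝ≥0∞) + 1) * σ n x
  have hSm : ∀ n, Measurable (S n) := fun n => (hσ n).1.const_mul _
  let k : X → ℝ≥0∞ := fun x => ρ x ⊔ ⨆ n, S n x
  have hSk : ∀ n, S n ≤ k := fun n x => (le_iSup (fun n => S n x) n).trans le_sup_right
  have hkm : Measurable k := hρ.sup (Measurable.iSup hSm)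
  refine ⟨k, hkm, fun x => le_sup_left, ?_, ?_⟩
  · have h1 : ∀ x, k x ^ p ≤ ρ x ^ p + ∑' n, S n x ^ p := by
      intro x
      have hs : (⨆ n, S n x) ^ p ≤ ∑' n, S n x ^ p := by
        have := (ENNReal.orderIsoRpow p hp).map_iSup fun n => S n x
        simp only [ENNReal.orderIsoRpow_apply] at this
        rw [this]
        exact iSup_le fun n => ENNReal.le_tsum n
      rcases le_total (ρ x) (⨆ n, S n x) with h | h
      · simp only [k, sup_of_le_right h]
        exact hs.trans le_add_self
      · simp only [k, sup_of_le_left h]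
        exact le_self_add
    refine ne_top_of_le_ne_top ?_ (lintegral_mono h1)
    rw [lintegral_add_left (hρ.pow_const p), lintegral_tsum fun n => ((hSm n).pow_const p).aemeasurable]
    refine ENNReal.add_ne_top.2 ⟨hρp.ne, ?_⟩
    have h2 : ∀ n, ∫⁻ x, S n x ^ p ∂m ≤ 2⁻¹ ^ n := by
      intro n
      simp only [S, ENNReal.mul_rpow_of_nonneg _ _ hp.le]
      rw [lintegral_const_mul _ ((hσ n).1.pow_const p)]
      refine (mul_le_mul_right (hσp n).le _).trans ?_
      rw [ENNReal.mul_div_cancel (hnp n) (hnp' n)]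
    refine ne_top_of_le_ne_top ?_ (ENNReal.tsum_le_tsum h2)
    rw [ENNReal.tsum_geometric, ENNReal.one_sub_inv_two, inv_inv]
    exact ENNReal.ofNat_ne_top
  · intro γ hγ
    refine ENNReal.eq_top_of_forall_nnreal_le fun r => ?_
    obtain ⟨n, hrn⟩ := exists_nat_ge r
    have h1 := (hσ n).2 γ hγ
    rw [show γ γ.a = γ 0 from congrArg γ hγ.1.1, show γ γ.b = γ 1 from congrArg γ hγ.1.2.1,
      one_mul] at h1
    calc (r : ℝ≥0∞) ≤ ((n : ℝ≥0∞) + 1) * 1 := by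
          rw [mul_one]
          exact le_trans (by exact_mod_cast hrn) le_self_add
      _ ≤ ((n : ℝ≥0∞) + 1) * (σ n (γ 0) + σ n (γ 1) + pathIntegral γ (σ n)) := by gcongr
      _ = S n (γ 0) + S n (γ 1) + pathIntegral γ (S n) := by
          rw [pathIntegral_const_mul γ (σ n) (hn n) (hn' n), mul_add, mul_add]
      _ ≤ k (γ 0) + k (γ 1) + pathIntegral γ k := by
          gcongr
          · exact hSk n _
          · exact hSk n _
          · exact pathIntegral_mono γ (hSk n)

end Modulus

end MetricCurve

/-! ### The representative along curves -/

namespace MetricCurve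

variable {X : Type*} [MetricSpace X] [TopologicalSpace.SeparableSpace X] [MeasurableSpace X]
  [BorelSpace X]

section Obstructs

variable {k ρ : X → ℝ≥0∞} {q : ℝ≥0∞} {f : X → ℝ}

theorem Obstructs.goodRep_comp (hk : Obstructs k q f ρ) (hkm : Measurable k) (hρ : Measurable ρ)
    (hρk : ρ ≤ k) {γ : Curve X} (hγ : γ ∈ LipCurves X) (hγk : pathIntegral γ k ≠ ∞) :
    AbsolutelyContinuousOnInterval (fun t => goodRep k f ρ (γ t)) 0 1 ∧
      DerivBound ρ γ (fun t => goodRep k f ρ (γ t)) ∧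
      ∀ᵐ t ∂(volume.restrict (Ioo (0 : ℝ) 1)),
        0 < metricSpeed γ t → goodRep k f ρ (γ t) = f (γ t) := by
  obtain ⟨K, hK⟩ := LipCurves.exists_lipschitzWith hγ
  rw [pathIntegral_eq_speedIntegral hγ hkm] at hγk
  have hm : ∀ {F : X → ℝ≥0∞}, Measurable F → AEMeasurable (fun t => F (γ t) * mspeed γ t) :=
    fun hF => (hF.comp hK.continuous.measurable).aemeasurable.mul (aemeasurable_mspeed hK)
  have hγρ : speedIntegral ρ γ 0 1 ≠ ∞ :=
    ne_top_of_le_ne_top hγk (speedIntegral_mono hρk _ _ _)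
  have hac := absolutelyContinuous_of_sub_le_lintegral (u := fun t => goodRep k f ρ (γ t))
    zero_le_one (hm hρ).restrict (by rwa [speedIntegral, uIcc_of_le zero_le_one] at hγρ)
    (fun s hs t ht hst => by
      have hss : uIcc s t ⊆ uIcc 0 1 := by
        rw [uIcc_of_le hst, uIcc_of_le zero_le_one]
        exact Icc_subset_Icc hs.1 ht.2
      have := hk.abs_goodRep_sub_goodRep_le hkm hρ hρk hK
        (ne_top_of_le_ne_top hγk (speedIntegral_mono_set k γ hss))
      rwa [speedIntegral, uIcc_of_le hst] at this)
  refine ⟨hac.1, hac.2, ?_⟩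
  rw [speedIntegral, uIcc_of_le zero_le_one] at hγk
  refine ae_restrict_of_ae_restrict_of_subset Ioo_subset_Icc_self ?_
  -- Finiteness of `k` times the speed forces `k < ∞` wherever the speed is positive.
  filter_upwards [ae_lt_top' (hm hkm).restrict hγk] with t ht hpos
  refine hk.goodRep_eq hkm hρ hρk fun htop => ?_
  simp only [htop] at ht
  rw [metricSpeed_eq_mspeed] at hpos
  rw [ENNReal.top_mul (ne_of_gt hpos)] at ht
  exact lt_irrefl _ ht

/-- The difference `D` has zero derivative a.e.: at zero speed both derivative bounds vanish, and at
positive speed `D = 0` a.e., where its derivative is zero at almost every point. So `D` is constant.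
-/
theorem Obstructs.goodRep_eq_of_isACRep (hk : Obstructs k q f ρ) (hkm : Measurable k)
    (hρ : Measurable ρ) (hρk : ρ ≤ k) {γ : Curve X} (hγ : γ ∈ LipCurves X) (hc : Nonconstant γ)
    (hγk : pathIntegral γ k ≠ ∞) {u : ℝ → ℝ} (hu : IsACRep f ρ γ u) {t : ℝ}
    (ht : t ∈ Icc (0 : ℝ) 1) : goodRep k f ρ (γ t) = u t := by
  obtain ⟨hac, hd, hpos⟩ := hk.goodRep_comp hkm hρ hρk hγ hγk
  let D : ℝ → ℝ := fun t => goodRep k f ρ (γ t) - u t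
  have hDac : AbsolutelyContinuousOnInterval D 0 1 := hac.sub hu.1
  have hDpos : ∀ᵐ t ∂(volume.restrict (Ioo (0 : ℝ) 1)), 0 < metricSpeed γ t → D t = 0 := by
    filter_upwards [hpos, hu.2.1] with t h1 h2 h3
    simp only [D, h1 h3, h2, sub_self]
  have hD0 : ∀ᵐ t ∂(volume.restrict (Ioo (0 : ℝ) 1)), HasDerivAt D 0 t := by
    filter_upwards [hDpos, hd, hu.2.2, ae_restrict_of_ae (ae_hasDerivAt_zero_of_eq_zero D)]
      with t h1 ⟨d₁, hd₁, hb₁, _⟩ ⟨d₂, hd₂, hb₂, _⟩ h4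
    have hD : HasDerivAt D (d₁ - d₂) t := hd₁.sub hd₂
    rcases eq_zero_or_pos (metricSpeed γ t) with h0 | h0
    · rw [h0, mul_zero, nonpos_iff_eq_zero, ENNReal.ofReal_eq_zero, abs_nonpos_iff] at hb₁ hb₂
      rwa [hb₁, hb₂, sub_zero] at hD
    · exact h4 (h1 h0) hD.differentiableAt
  obtain ⟨C, hC⟩ := hDac.const_of_ae_hasDerivAt_zero (by
    rw [uIcc_of_le zero_le_one, ← ae_restrict_iff' measurableSet_Icc,
      ← restrict_Ioo_eq_restrict_Icc]
    exact hD0)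
  rw [uIcc_of_le zero_le_one] at hC
  -- A nonzero constant would exclude positive speed a.e. and make `γ` constant.
  have hC0 : C = 0 := by
    by_contra hne
    obtain ⟨K, hK⟩ := LipCurves.exists_lipschitzWith hγ
    have hzero : ∀ᵐ r, r ∈ Icc (0 : ℝ) 1 → mspeed γ r = 0 := by
      rw [← ae_restrict_iff' measurableSet_Icc, ← restrict_Ioo_eq_restrict_Icc]
      filter_upwards [hDpos, ae_restrict_mem measurableSet_Ioo] with r h1 h2
      by_contra h3
      exact hne ((hC r (Ioo_subset_Icc_self h2)).symm.trans (h1 (pos_iff_ne_zero.2 h3)))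
    have hconst : ∀ r ∈ Icc (0 : ℝ) 1, γ 0 = γ r := fun r hr => by
      refine eq_of_mspeed_eq_zero hK hr.1 ?_
      filter_upwards [hzero] with x hx hxr using hx ⟨hxr.1, hxr.2.trans hr.2⟩
    obtain ⟨s, hs, t, ht, hst⟩ := hc
    have hI : Icc γ.a γ.b = Icc 0 1 := by rw [hγ.1, hγ.2.1]
    exact hst ((hconst s (hI ▸ hs)).symm.trans (hconst t (hI ▸ ht)))
  have := hC t ht
  rw [hC0] at this
  exact sub_eq_zero.1 this

end Obstructs

end MetricCurve

theorem mainTheorem8 {X : Type*} [MetricSpace X] [CompleteSpace X]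
    [TopologicalSpace.SeparableSpace X] [MeasurableSpace X] [BorelSpace X]
    (m : Measure X)
    (hm : ∀ B : Set X, MeasurableSet B → Bornology.IsBounded B → m B < ∞)
    (p : ℝ) (hp : 1 ≤ p) (q : ℝ≥0∞) (hpq : (ENNReal.ofReal p).HolderConjugate q)
    (f : X → ℝ) (hf : Measurable f) (hfp : ∫⁻ x, ENNReal.ofReal |f x| ^ p ∂m < ∞)
    (ρ : X → ℝ≥0∞) (hρ : Measurable ρ) (hρp : ∫⁻ x, ρ x ^ p ∂m < ∞)
    (hmod : modulus m p 1 (badCurves q f ρ) = 0) :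
    ∃ fhat : X → ℝ, NullMeasurable fhat m ∧ fhat =ᵐ[m] f ∧
      -- along a.e. nonconstant curve of `C_{f,ρ}`, `fhat ∘ γ` equals `f_γ` everywhere on `[0,1]`
      ModAE m p {γ | γ ∈ goodCurves f ρ ∧ Nonconstant γ}
        (fun γ => ∀ u : ℝ → ℝ, IsACRep f ρ γ u → ∀ t ∈ Icc (0 : ℝ) 1, fhat (γ t) = u t) ∧
      -- a.e. Lipschitz curve with a.e. positive speed belongs to `C_{f,ρ}`
      ModAE m p
        {γ | γ ∈ LipCurves X ∧ ∀ᵐ t ∂(volume.restrict (Ioo (0 : ℝ) 1)), 0 < metricSpeed γ t}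
        (fun γ => γ ∈ goodCurves f ρ) ∧
      -- along a.e. nonconstant Lipschitz curve, `fhat ∘ γ` is absolutely continuous, satisfies the
      -- derivative bound, and agrees with `f ∘ γ` a.e. where the speed is positive
      ModAE m p {γ | γ ∈ LipCurves X ∧ Nonconstant γ}
        (fun γ => AbsolutelyContinuousOnInterval (fun t => fhat (γ t)) 0 1 ∧
          DerivBound ρ γ (fun t => fhat (γ t)) ∧
          ∀ᵐ t ∂(volume.restrict (Ioo (0 : ℝ) 1)),
            0 < metricSpeed γ t → fhat (γ t) = f (γ t)) := by
  have hp0 : 0 < p := zero_lt_one.trans_le hp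
  obtain ⟨k, hkm, hρk, hkp, hk⟩ := exists_obstructs hp0 hρ hρp hmod
  have hae : goodRep k f ρ =ᵐ[m] f := by
    filter_upwards [ae_lt_top (hkm.pow_const p) hkp] with x hx
    exact hk.goodRep_eq hkm hρ hρk fun htop => by simp [htop, hp0] at hx
  have hmodAE : ∀ {Γ : Set (Curve X)} {P : Curve X → Prop},
      (∀ γ ∈ Γ, pathIntegral γ k ≠ ∞ → P γ) → ModAE m p Γ P := fun h =>
    modulus_eq_zero_of_pathIntegral_eq_top hp0 hkm hkp fun γ hγ =>
      by_contra fun hne => hγ.2 (h γ hγ.1 hne)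
  -- Measurability is inherited from `f` by a.e. equality, not from the supremum over curves.
  refine ⟨goodRep k f ρ, hf.nullMeasurable.congr hae.symm, hae, ?_, ?_, ?_⟩
  · exact hmodAE fun γ hγ hfin u hu t ht =>
      hk.goodRep_eq_of_isACRep hkm hρ hρk hγ.1.1 hγ.2 hfin hu ht
  · refine hmodAE fun γ hγ hfin => ⟨hγ.1, fun t => goodRep k f ρ (γ t), ?_⟩
    obtain ⟨h1, h2, h3⟩ := hk.goodRep_comp hkm hρ hρk hγ.1 hfin
    refine ⟨h1, ?_, h2⟩
    -- Positive speed a.e. makes `fhat ∘ γ` agree with `f ∘ γ` a.e., so it is the required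
    -- representative.
    filter_upwards [hγ.2, h3] with t h4 h5 using h5 h4
  · exact hmodAE fun γ hγ hfin => hk.goodRep_comp hkm hρ hρk hγ.1 hfin
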